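/- **Theorem (cut regions vs. acceptance domains).** Let $G$ and $H$ be connected, simply connected, at most two-step nilpotent real Lie groups, identified with their Lie algebras by the exponential map, so that $xy=x+y+\tfrac12[x,y]$. Each is equipped with a family of dilations $D_r=\exp(\ln(r)A)$, $r>0$, where $A$ is diagonalisable with positive eigenvalues and every $D_r$ is a Lie algebra morphism, and with a homogeneous norm $|\cdot|$ (continuous, non-negative, $|x^{-1}|=|x|$, $|D_rx|=r|x|$, $|x|=0$ iff $x=e$, $|xy|\le|x|+|y|$). Put $B_r(x)=\{y : |yx^{-1}|<r\}$. Let $\Gamma\subset G\times H$ be a uniform lattice such that $\pi_G|_\Gamma$ is injective and $\Gamma_H=\pi_H(\Gamma)$ is dense in $H$, and put $\tau=\pi_H\circ(\pi_G|_\Gamma)^{-1}$. Let $W=\bigcap_{i=1}^N P_i^+\subset H$ be a precompact polytope with non-empty interior, given by an irredundant list of closed half-spaces $P_i^+$ with bounding hyperplanes $P_i$, and suppose $\partial W\cap\Gamma_H=\emptyset$. Let $\Lambda=\pi_G((G\times W)\cap\Gamma)$. For $r>0$ call $\lambda,\mu\in\Lambda$ equivalent if $(B_r(\lambda)\cap\Lambda)\lambda^{-1}=(B_r(\mu)\cap\Lambda)\mu^{-1}$,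 and let $A_r^H$ be the set of the images under $\tau$ of the equivalence classes. Let $\mathcal S_r=\{\pi_H(\gamma) : \gamma\in\Gamma,\ |\pi_G(\gamma)|<r,\ \pi_H(\gamma)\in WW^{-1}\}$. Write $\#\pi_0$ for the number of connected components. 1. For all $r>0$, $$|A_r^H|\le\#\pi_0\Big(H\setminus\bigcup_{\mu\in\mathcal S_r}\bigcup_{i=1}^N\mu P_i\Big).$$ 2. Put $\partial_iW=W\cap P_i$, $F_i=\sup\{r\in\mathbb R : \exists p\in P_i,\ B_r(p)\cap\partial_iW=B_r(p)\cap P_i\}\in[0,\infty]$ and $F_W=\min_iF_i$ (with $F_W=\infty$ if $N=0$). There are a center $c_W\in W$, i.e. a point that maximises $\sup\{r : B_r(c)\subset W\}$ over $c\in W$, and face centers $p_i\in\partial_iW$ with $B_{F_W}(p_i)\cap\partial_iW=B_{F_W}(p_i)\cap P_i$ for all $i$. 3. For every choice of such $c_W$ and $p_i$, put $I_W=\sup\{r : B_r(c_W)\subset W\}$, $O_W=\inf\{r : W\subset B_r(c_W)\}$ and $U_i=B_k(c_Wp_i^{-1})$. Call $(k,h)\in\mathbb R^2$ a *good pair* if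 $0<k<h<I_W$, if $|axa^{-1}|\le F_W$ for all $a\in B_{O_W}(e)$ and $x\in B_{2h}(e)$, and if $sP_i^+\cap B_h(c_W)=sW\cap B_h(c_W)$ for all $i$ and all $s\in U_i$. Then a good pair exists. Moreover, for every good pair $(k,h)$ for which the ball $B_h(c_W)$ is convex, we have $B_h(c_W)\subset W$ and, for all $r>0$, $$\#\pi_0\Big(B_h(c_W)\setminus\bigcup_{i=1}^N\bigcup_{s\in U_i(r)}sP_i\Big)\le|A_r^H|,\qquad U_i(r)=\pi_H\big((B_r(e)\times U_i)\cap\Gamma\big).$$ 4. $H$ carries a homogeneous norm (for the same dilations) all of whose balls are convex. -/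

import Mathlib

namespace CutRegions

/-- `G` is a connected, simply connected, at most two-step nilpotent Lie group in exponential
coordinates: the underlying set of the group is its Lie algebra, and the group law is the
Baker-Campbell-Hausdorff product, which for `⁅x, ⁅y, z⁆⁆ = 0` reads `x + y + ⁅x, y⁆ / 2`.
(It follows that `1 = 0` and `x⁻¹ = -x`.) -/
class TwoStepExpGroup (G : Type*) [LieRing G] [LieAlgebra ℝ G] [Group G] : Prop where
  lie_lie_eq_zero : ∀ x y z : G, ⁅x, ⁅y, z⁆⁆ = 0
  mul_eq_bch : ∀ x y : G, x * y = x + y + (1 / 2 : ℝ) • ⁅x, y⁆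

/-- A family of dilations: `D r = exp (log r • A)` for `r > 0`, with `A` diagonalisable with
positive eigenvalues (`A (b i) = ν i • b i`), and every `D r` is a Lie algebra morphism. -/
structure IsDilationFamily {G : Type*} [LieRing G] [LieAlgebra ℝ G]
    (D : ℝ → G →ₗ[ℝ] G) : Prop where
  exists_weights : ∃ (n : ℕ) (b : Module.Basis (Fin n) ℝ G) (ν : Fin n → ℝ),
    (∀ i, 0 < ν i) ∧ ∀ r : ℝ, 0 < r → ∀ i, D r (b i) = (r ^ ν i : ℝ) • b i
  map_lie : ∀ r : ℝ, 0 < r → ∀ x y : G, D r ⁅x, y⁆ = ⁅D r x, D r y⁆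

/-- Homogeneous norms with respect to a family of dilations. -/
structure IsHomogeneousNorm {G : Type*} [LieRing G] [LieAlgebra ℝ G] [Group G]
    [TopologicalSpace G] (D : ℝ → G →ₗ[ℝ] G) (n : G → ℝ) : Prop where
  continuous : Continuous n
  nonneg : ∀ x, 0 ≤ n x
  inv : ∀ x, n x⁻¹ = n x
  dilation : ∀ r : ℝ, 0 < r → ∀ x, n (D r x) = r * n x
  eq_zero_iff : ∀ x, n x = 0 ↔ x = 1
  mul_le : ∀ x y, n (x * y) ≤ n x + n y

/-- The open ball `B_R(x)` of the right-invariant metric `d(y, x) = |y x⁻¹|`. The radius is an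
extended real, since the size of a face may be infinite. -/
def ball {G : Type*} [Group G] (n : G → ℝ) (R : EReal) (x : G) : Set G :=
  {y | (n (y * x⁻¹) : EReal) < R}

/-- The left translate `s A`. -/
def leftTranslate {G : Type*} [Group G] (s : G) (A : Set G) : Set G := (fun x => s * x) '' A

/-- The number of connected components of a subset, `⊤` if there are infinitely many. -/
noncomputable def numComponents {X : Type*} [TopologicalSpace X] (S : Set X) : ℕ∞ :=
  ENat.card (ConnectedComponents S)

section ModelSets

variable {G H : Type*} [Group G] [Group H]

/-- `(G, H, Γ)` is a cut-and-project scheme with `Γ` a uniform lattice in `G × H`. -/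
structure IsUniformCPS [TopologicalSpace G] [TopologicalSpace H]
    (Γ : Subgroup (G × H)) : Prop where
  discrete : DiscreteTopology Γ
  cocompact : CompactSpace ((G × H) ⧸ Γ)
  injOn_fst : Set.InjOn Prod.fst (Γ : Set (G × H))
  dense_snd : Dense (Prod.snd '' (Γ : Set (G × H)))

/-- The set `Λ(G, H, Γ, W) = π_G ((G × W) ∩ Γ)`. -/
def modelSet (Γ : Subgroup (G × H)) (W : Set H) : Set G :=
  Prod.fst '' {γ : G × H | γ ∈ Γ ∧ γ.2 ∈ W}

/-- The shifted patch `P_r(x) x⁻¹`, where `P_r(x) = B_r(x) ∩ Λ`. -/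
def centeredPatch (n : G → ℝ) (Λ : Set G) (r : ℝ) (x : G) : Set G :=
  (fun y => y * x⁻¹) '' (ball n r x ∩ Λ)

/-- The class `A_r^G(x)` of points of `Λ` that have the same `r`-patch as `x`. -/
def patchClass (n : G → ℝ) (Λ : Set G) (r : ℝ) (x : G) : Set G :=
  {y | y ∈ Λ ∧ centeredPatch n Λ r x = centeredPatch n Λ r y}

/-- The `r`-pre-acceptance domain `A_r^H(x) = τ (A_r^G(x))`. Here `τ = π_H ∘ (π_G|Γ)⁻¹` is the
map whose graph is `Γ`. -/
def preAcceptanceDomain (n : G → ℝ) (Γ : Subgroup (G × H)) (W : Set H) (r : ℝ) (x : G) :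
    Set H :=
  {y | ∃ g ∈ patchClass n (modelSet Γ W) r x, (g, y) ∈ Γ}

/-- The set `A_r^H` of all `r`-pre-acceptance domains. -/
def preAcceptanceDomains (n : G → ℝ) (Γ : Subgroup (G × H)) (W : Set H) (r : ℝ) :
    Set (Set H) :=
  {A | ∃ x ∈ modelSet Γ W, A = preAcceptanceDomain n Γ W r x}

/-- The `r`-slab `S_r`. -/
def slab (n : G → ℝ) (Γ : Subgroup (G × H)) (W : Set H) (r : ℝ) : Set H :=
  Prod.snd '' {γ : G × H | γ ∈ Γ ∧ n γ.1 < r ∧ ∃ a ∈ W, ∃ b ∈ W, γ.2 = a * b⁻¹}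

/-- `π_H ((B_r(e) × U) ∩ Γ)`. -/
def latticePart (n : G → ℝ) (Γ : Subgroup (G × H)) (U : Set H) (r : ℝ) : Set H :=
  Prod.snd '' {γ : G × H | γ ∈ Γ ∧ γ.1 ∈ ball n r 1 ∧ γ.2 ∈ U}

end ModelSets

/-- A finite irredundant list of closed half-spaces `P_i⁺ = {x | normal i x ≤ offset i}`:
no half-space contains the intersection of the others, so that each hyperplane `P_i` really
bounds the intersection. -/
structure HalfSpaces (H : Type*) [AddCommGroup H] [Module ℝ H] where
  N : ℕ
  normal : Fin N → H →ₗ[ℝ] ℝ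
  offset : Fin N → ℝ
  normal_ne_zero : ∀ i, normal i ≠ 0
  irredundant : ∀ i, ∃ x, (∀ j, j ≠ i → normal j x ≤ offset j) ∧ offset i < normal i x

namespace HalfSpaces

section Linear

variable {H : Type*} [AddCommGroup H] [Module ℝ H] (P : HalfSpaces H)

/-- The half-space `P_i⁺`. -/
def half (i : Fin P.N) : Set H := {x | P.normal i x ≤ P.offset i}

/-- The bounding hyperplane `P_i`. -/
def plane (i : Fin P.N) : Set H := {x | P.normal i x = P.offset i}

/-- The window `W`, the intersection of the half-spaces. -/
def window : Set H := ⋂ i, P.half i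

/-- The face `∂_i W = W ∩ P_i`. -/
def face (i : Fin P.N) : Set H := P.window ∩ P.plane i

end Linear

variable {H : Type*} [LieRing H] [LieAlgebra ℝ H] [Group H] (P : HalfSpaces H) (n : H → ℝ)

/-- `sup {r | B_r(c) ⊆ W}`; this is the inner radius `I_W` if `c` is the center of the window. -/
noncomputable def innerRadius (c : H) : EReal :=
  sSup ((fun r : ℝ => (r : EReal)) '' {r | ball n r c ⊆ P.window})

/-- `inf {r | W ⊆ B_r(c)}`; this is the outer radius `O_W` if `c` is the center of the window. -/
noncomputable def outerRadius (c : H) : EReal :=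
  sInf ((fun r : ℝ => (r : EReal)) '' {r | P.window ⊆ ball n r c})

/-- The size `F_i` of the face `∂_i W`. -/
noncomputable def faceSize (i : Fin P.N) : EReal :=
  sSup ((fun r : ℝ => (r : EReal)) ''
    {r | ∃ p ∈ P.plane i, ball n r p ∩ P.face i = ball n r p ∩ P.plane i})

/-- The minimum `F_W` of the sizes of the faces. -/
noncomputable def minFaceSize : EReal := ⨅ i, P.faceSize n i

/-- `c` is a center of the window: it maximises `sup {r | B_r(c) ⊆ W}` over `W`. -/
def IsCenter (c : H) : Prop :=
  c ∈ P.window ∧ ∀ x ∈ P.window, P.innerRadius n x ≤ P.innerRadius n c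

/-- `p i` is a face center of `∂_i W` for every `i`. -/
def AreFaceCenters (p : Fin P.N → H) : Prop :=
  ∀ i, p i ∈ P.face i ∧
    ball n (P.minFaceSize n) (p i) ∩ P.face i = ball n (P.minFaceSize n) (p i) ∩ P.plane i

/-- The region `U_i = B_k(c p_i⁻¹)`. -/
def region (c : H) (p : Fin P.N → H) (k : ℝ) (i : Fin P.N) : Set H :=
  ball n k (c * (p i)⁻¹)

/-- `(k, h)` is a good pair, for the window center `c` and the face centers `p`. -/
structure IsGoodPair (c : H) (p : Fin P.N → H) (k h : ℝ) : Prop where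
  pos : 0 < k
  lt : k < h
  lt_innerRadius : (h : EReal) < P.innerRadius n c
  conj_le : ∀ a ∈ ball n (P.outerRadius n c) 1, ∀ x ∈ ball n ((2 * h : ℝ) : EReal) 1,
    (n (a * x * a⁻¹) : EReal) ≤ P.minFaceSize n
  half_eq : ∀ i, ∀ s ∈ P.region n c p k i,
    leftTranslate s (P.half i) ∩ ball n h c = leftTranslate s P.window ∩ ball n h c

end HalfSpaces

end CutRegions

open CutRegions

/-!
The classes of points of the model set `Λ` are read off in `H`: two points of `Λ` with images `w`
and `w'` in `H` have the same `r`-patch if and only if, for every lattice vector `(z, u)` with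
`|z| < r`, the points `u w` and `u w'` lie in the window simultaneously
(`preAcceptanceDomain_eq_iff`). Only `u` in the slab `S_r` matter, and properness of homogeneous
norms (`IsHomogeneousNorm.exists_isCompact`) together with discreteness of the lattice makes the
slab finite. Translations are affine maps in exponential coordinates, so all cuts `u P_i` are
hyperplanes.

Upper bound. Along a connected component of the complement of the cuts, no point changes sides
with respect to a cut, so the component determines the class. A point `w` of `Γ_H` may lie on a cut
although it lies on the boundary of no translate of `W`; since the cuts are finitely many, `w` can
be moved into their complement within its class (`exists_mem_compl_cuts`).

Lower bound. A convex ball cut by finitely many hyperplanes decomposes into convex cells, each of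
which contains a point of the dense set `Γ_H`, and two different cells are separated by some
`s P_i`. By the defining property of good pairs, `s P_i⁺` and `s W` agree within the ball, so the
short lattice vector over `s⁻¹` moves exactly one of the two points into `W`, and their classes
differ (`numComponents_le_encard`).

Centers maximise upper semicontinuous radii over compact sets. A good pair exists because, by
irredundance, faces have relatively interior points, so that `F_W > 0` and the window agrees with
the half-space `P_i⁺` near the face center `p_i`.

Norms with convex balls are gauges of small boxes (`exists_convex_homogeneousNorm`). The triangle
inequality requires weights of at least `1`, which the subadditivity of the given norm forces.
-/

namespace CutRegions

/-! ### Two-step groups in exponential coordinates -/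

section ExpGroup

variable {E : Type*} [LieRing E] [LieAlgebra ℝ E] [Group E] [TwoStepExpGroup E]

theorem one_eq_zero : (1 : E) = 0 := by
  have h := TwoStepExpGroup.mul_eq_bch (1 : E) 1
  rw [mul_one, lie_self, smul_zero, add_zero] at h
  exact left_eq_add.1 h

theorem inv_eq_neg (x : E) : x⁻¹ = -x := by
  rw [inv_eq_iff_mul_eq_one, TwoStepExpGroup.mul_eq_bch, one_eq_zero]
  simp

theorem mul_self_eq_two_smul (x : E) : x * x = (2 : ℝ) • x := by
  rw [TwoStepExpGroup.mul_eq_bch, lie_self, smul_zero, add_zero, two_smul]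

theorem mul_convexComb (s x y : E) {a b : ℝ} (hab : a + b = 1) :
    s * (a • x + b • y) = a • (s * x) + b • (s * y) := by
  simp only [TwoStepExpGroup.mul_eq_bch, lie_add, lie_smul]
  have : s = a • s + b • s := by rw [← add_smul, hab, one_smul]
  nth_rewrite 1 [this]
  module

theorem convexComb_mul (s x y : E) {a b : ℝ} (hab : a + b = 1) :
    (a • x + b • y) * s = a • (x * s) + b • (y * s) := by
  simp only [TwoStepExpGroup.mul_eq_bch, add_lie, smul_lie]
  have : s = a • s + b • s := by rw [← add_smul, hab, one_smul]
  nth_rewrite 1 [this]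
  module

end ExpGroup

theorem continuous_lie {E : Type*} [LieRing E] [LieAlgebra ℝ E] [FiniteDimensional ℝ E]
    [TopologicalSpace E] [IsTopologicalAddGroup E] [ContinuousSMul ℝ E] [T2Space E] :
    Continuous fun p : E × E => ⁅p.1, p.2⁆ := by
  let b := Module.finBasis ℝ E
  have h : ∀ p : E × E, ⁅p.1, p.2⁆ = ∑ i, b.coord i p.1 • ⁅b i, p.2⁆ := by
    intro p
    conv_lhs => rw [← b.sum_repr p.1]
    rw [sum_lie]
    simp
  simp_rw [h]
  refine continuous_finsetSum _ fun i _ => ?_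
  have h1 : Continuous (b.coord i) := LinearMap.continuous_of_finiteDimensional _
  have h2 : Continuous fun y : E => ⁅b i, y⁆ :=
    LinearMap.continuous_of_finiteDimensional (LieAlgebra.ad ℝ E (b i) : E →ₗ[ℝ] E)
  exact (h1.comp continuous_fst).smul (h2.comp continuous_snd)

instance isTopologicalGroup {E : Type*} [LieRing E] [LieAlgebra ℝ E] [Group E]
    [TwoStepExpGroup E] [FiniteDimensional ℝ E] [TopologicalSpace E] [IsTopologicalAddGroup E]
    [ContinuousSMul ℝ E] [T2Space E] : IsTopologicalGroup E where
  continuous_mul := by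
    have h : (fun p : E × E => p.1 * p.2) = fun p => p.1 + p.2 + (1 / 2 : ℝ) • ⁅p.1, p.2⁆ := by
      funext p; exact TwoStepExpGroup.mul_eq_bch _ _
    rw [h]
    exact (continuous_fst.add continuous_snd).add (continuous_lie.const_smul _)
  continuous_inv := by
    have h : (fun x : E => x⁻¹) = fun x => -x := funext inv_eq_neg
    rw [h]
    exact continuous_neg

/-! ### Weighted box gauges and homogeneous norms -/

section Gauge

variable {E : Type*} [AddCommGroup E] [Module ℝ E] {m : ℕ}

/-- The gauge `max_i (|x_i| / ε) ^ (1 / ν_i)` of the box `{x | |x_i| ≤ ε}` with respect to the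
dilations that scale the `i`-th coordinate by `r ^ ν_i`. The maximum is the norm of
`Fin m → ℝ`. -/
noncomputable def boxGauge (b : Module.Basis (Fin m) ℝ E) (ν : Fin m → ℝ) (ε : ℝ) (x : E) : ℝ :=
  ‖fun i => (|b.repr x i| / ε) ^ (1 / ν i)‖

variable {b : Module.Basis (Fin m) ℝ E} {ν : Fin m → ℝ} {ε : ℝ}

theorem boxGauge_le_iff (hν : ∀ i, 0 < ν i) (hε : 0 < ε) {x : E} {t : ℝ} (ht : 0 ≤ t) :
    boxGauge b ν ε x ≤ t ↔ ∀ i, |b.repr x i| ≤ ε * t ^ ν i := by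
  rw [boxGauge, pi_norm_le_iff_of_nonneg ht]
  refine forall_congr' fun i => ?_
  have h0 : 0 ≤ |b.repr x i| / ε := by positivity
  rw [Real.norm_of_nonneg (Real.rpow_nonneg h0 _), one_div,
    Real.rpow_inv_le_iff_of_pos h0 ht (hν i), div_le_iff₀' hε]

theorem boxGauge_lt_iff (hν : ∀ i, 0 < ν i) (hε : 0 < ε) {x : E} {t : ℝ} (ht : 0 < t) :
    boxGauge b ν ε x < t ↔ ∀ i, |b.repr x i| < ε * t ^ ν i := by
  rw [boxGauge, pi_norm_lt_iff ht]
  refine forall_congr' fun i => ?_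
  have h0 : 0 ≤ |b.repr x i| / ε := by positivity
  rw [Real.norm_of_nonneg (Real.rpow_nonneg h0 _), one_div,
    Real.rpow_inv_lt_iff_of_pos h0 ht.le (hν i), div_lt_iff₀' hε]

theorem boxGauge_nonneg (x : E) : 0 ≤ boxGauge b ν ε x := norm_nonneg _

theorem boxGauge_neg (x : E) : boxGauge b ν ε (-x) = boxGauge b ν ε x := by
  simp [boxGauge]

theorem boxGauge_eq_zero_iff (hν : ∀ i, 0 < ν i) (hε : 0 < ε) {x : E} :
    boxGauge b ν ε x = 0 ↔ x = 0 := by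
  rw [← (boxGauge_nonneg x).ge_iff_eq', boxGauge_le_iff hν hε le_rfl, ← b.repr.map_eq_zero_iff,
    Finsupp.ext_iff]
  refine forall_congr' fun i => ?_
  rw [Real.zero_rpow (hν i).ne', mul_zero, abs_nonpos_iff, Finsupp.zero_apply]

theorem repr_dilation {D : E →ₗ[ℝ] E} {r : ℝ} (hD : ∀ i, D (b i) = (r ^ ν i : ℝ) • b i)
    (x : E) (i : Fin m) : b.repr (D x) i = r ^ ν i * b.repr x i := by
  have : b.coord i ∘ₗ D = (r ^ ν i : ℝ) • b.coord i := by
    refine b.ext fun j => ?_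
    simp only [LinearMap.comp_apply, hD, LinearMap.smul_apply, map_smul, smul_eq_mul,
      Module.Basis.coord_apply, Module.Basis.repr_self]
    by_cases h : j = i
    · rw [h]
    · simp [h]
  exact LinearMap.congr_fun this x

theorem boxGauge_dilation (hν : ∀ i, 0 < ν i) (hε : 0 < ε) {D : E →ₗ[ℝ] E} {r : ℝ} (hr : 0 < r)
    (hD : ∀ i, D (b i) = (r ^ ν i : ℝ) • b i) (x : E) :
    boxGauge b ν ε (D x) = r * boxGauge b ν ε x := by
  have h : (fun i => (|b.repr (D x) i| / ε) ^ (1 / ν i)) =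
      r • fun i => (|b.repr x i| / ε) ^ (1 / ν i) := by
    funext i
    have h1 : 0 < r ^ ν i := Real.rpow_pos_of_pos hr _
    rw [repr_dilation hD, abs_mul, abs_of_pos h1, mul_div_assoc,
      Real.mul_rpow h1.le (by positivity), ← Real.rpow_mul hr.le, mul_one_div_cancel (hν i).ne',
      Real.rpow_one]
    rfl
  rw [boxGauge, h, norm_smul, Real.norm_of_nonneg hr.le, boxGauge]

variable [TopologicalSpace E] [IsTopologicalAddGroup E] [ContinuousSMul ℝ E]

theorem exists_isCompact_box (b : Module.Basis (Fin m) ℝ E) (R : ℝ) :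
    ∃ K : Set E, IsCompact K ∧ ∀ x, (∀ i, |b.repr x i| ≤ R) → x ∈ K := by
  refine ⟨b.equivFun.symm '' Set.univ.pi fun _ => Set.Icc (-R) R, ?_, fun x hx => ?_⟩
  · refine (isCompact_univ_pi fun _ => isCompact_Icc).image ?_
    exact LinearMap.continuous_of_finiteDimensional (b.equivFun.symm : (Fin m → ℝ) →ₗ[ℝ] E)
  · exact ⟨b.equivFun x, fun i _ => abs_le.1 (hx i), b.equivFun.symm_apply_apply x⟩

theorem continuous_boxGauge [T2Space E] (hν : ∀ i, 0 < ν i) : Continuous (boxGauge b ν ε) := by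
  have : FiniteDimensional ℝ E := b.finiteDimensional_of_finite
  refine continuous_norm.comp (continuous_pi fun i => ?_)
  have h : Continuous (b.coord i) := LinearMap.continuous_of_finiteDimensional _
  exact (h.abs.div_const ε).rpow_const fun _ => Or.inr (one_div_pos.2 (hν i)).le

end Gauge

/-- Subadditivity forces all weights to be at least `1`: the square of `b` is `2 • b`, of norm
`2 ^ (1 / ν) |b| ≤ 2 |b|`. -/
theorem IsHomogeneousNorm.one_le_weight {E : Type*} [LieRing E] [LieAlgebra ℝ E]
    [Group E] [TwoStepExpGroup E] [TopologicalSpace E] {D : ℝ → E →ₗ[ℝ] E} {n : E → ℝ}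
    (hn : IsHomogeneousNorm D n) {x : E} (hx : x ≠ 0) {ν : ℝ} (hν : 0 < ν)
    (hDx : ∀ r : ℝ, 0 < r → D r x = (r ^ ν : ℝ) • x) : 1 ≤ ν := by
  have hpos : 0 < n x := (hn.nonneg x).lt_of_ne' fun h => by
    rw [hn.eq_zero_iff, one_eq_zero] at h; exact hx h
  have h2 : (0 : ℝ) < 2 ^ (1 / ν) := by positivity
  have h := hn.mul_le x x
  rw [mul_self_eq_two_smul] at h
  have h3 : D (2 ^ (1 / ν)) x = (2 : ℝ) • x := by
    rw [hDx _ h2, ← Real.rpow_mul zero_le_two, one_div_mul_cancel hν.ne', Real.rpow_one]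
  rw [← h3, hn.dilation _ h2, ← two_mul] at h
  have h4 : (2 : ℝ) ^ (1 / ν) ≤ 2 ^ (1 : ℝ) := by
    rw [Real.rpow_one]; exact le_of_mul_le_mul_right h hpos
  rw [Real.rpow_le_rpow_left_iff one_lt_two, div_le_one hν] at h4
  exact h4

/-- Weights add under the bracket. -/
theorem weight_add_eq {E : Type*} [LieRing E] [LieAlgebra ℝ E]
    {D : ℝ → E →ₗ[ℝ] E} {m : ℕ} {b : Module.Basis (Fin m) ℝ E} {ν : Fin m → ℝ}
    (hD : IsDilationFamily D)
    (hDb : ∀ r : ℝ, 0 < r → ∀ i, D r (b i) = (r ^ ν i : ℝ) • b i) {i j k : Fin m}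
    (h : b.repr ⁅b j, b k⁆ i ≠ 0) : ν j + ν k = ν i := by
  have h1 := hD.map_lie 2 two_pos (b j) (b k)
  rw [hDb 2 two_pos, hDb 2 two_pos, smul_lie, lie_smul, smul_smul,
    ← Real.rpow_add two_pos] at h1
  have h2 := repr_dilation (hDb 2 two_pos) ⁅b j, b k⁆ i
  rw [h1, map_smul, Finsupp.smul_apply, smul_eq_mul] at h2
  have h3 := mul_right_cancel₀ h h2
  exact (Real.rpow_right_inj two_pos (by norm_num)).1 h3

theorem rpow_mul_rpow_le {s t p q : ℝ} (hs : 0 ≤ s) (ht : 0 ≤ t) (hp : 1 ≤ p) (hq : 1 ≤ q) :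
    s ^ p * t ^ q ≤ (s + t) ^ (p + q) - s ^ (p + q) - t ^ (p + q) := by
  have h1 := Real.add_rpow_le_rpow_add hs ht hp
  have h2 := Real.add_rpow_le_rpow_add hs ht hq
  have hs' := Real.rpow_nonneg hs
  have ht' := Real.rpow_nonneg ht
  have h3 := mul_le_mul h1 h2 (add_nonneg (hs' q) (ht' q)) (Real.rpow_nonneg (add_nonneg hs ht) _)
  have hpq : 0 < p + q := by linarith
  rw [Real.rpow_add_of_nonneg (add_nonneg hs ht) (by linarith) (by linarith),
    Real.rpow_add_of_nonneg hs (by linarith) (by linarith),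
    Real.rpow_add_of_nonneg ht (by linarith) (by linarith)]
  nlinarith [mul_nonneg (ht' p) (hs' q)]

theorem repr_lie {E : Type*} [LieRing E] [LieAlgebra ℝ E] {m : ℕ}
    (b : Module.Basis (Fin m) ℝ E) (x y : E) (i : Fin m) :
    b.repr ⁅x, y⁆ i = ∑ j, ∑ k, b.repr x j * b.repr y k * b.repr ⁅b j, b k⁆ i := by
  conv_lhs => rw [← b.sum_repr x, ← b.sum_repr y]
  simp only [sum_lie, lie_sum, smul_lie, lie_smul, map_sum, map_smul,
    Finsupp.coe_finsetSum, Finset.sum_apply, Finsupp.smul_apply, smul_eq_mul]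
  rw [Finset.sum_comm]
  simp only [Finset.mul_sum]
  exact Finset.sum_congr rfl fun j _ => Finset.sum_congr rfl fun k _ => by ring

/-- Only pairs of weights `ν_j + ν_k = ν_i` contribute to the `i`-th coordinate of a bracket, and
for weights at least `1` the product `s ^ ν_j * t ^ ν_k` is dominated by the defect
`(s + t) ^ ν_i - s ^ ν_i - t ^ ν_i`. -/
theorem abs_repr_lie_le {E : Type*} [LieRing E] [LieAlgebra ℝ E] {D : ℝ → E →ₗ[ℝ] E} {m : ℕ}
    {b : Module.Basis (Fin m) ℝ E} {ν : Fin m → ℝ} (hD : IsDilationFamily D)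
    (hDb : ∀ r : ℝ, 0 < r → ∀ i, D r (b i) = (r ^ ν i : ℝ) • b i) (hν : ∀ i, 1 ≤ ν i)
    {x y : E} {ε s t : ℝ} (hε : 0 ≤ ε) (hs : 0 ≤ s) (ht : 0 ≤ t)
    (hx : ∀ i, |b.repr x i| ≤ ε * s ^ ν i) (hy : ∀ i, |b.repr y i| ≤ ε * t ^ ν i) (i : Fin m) :
    |b.repr ⁅x, y⁆ i| ≤ ε * ε * ((s + t) ^ ν i - s ^ ν i - t ^ ν i) *
      ∑ j, ∑ k, |b.repr ⁅b j, b k⁆ i| := by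
  have hterm : ∀ j k, |b.repr x j * b.repr y k * b.repr ⁅b j, b k⁆ i| ≤
      ε * ε * ((s + t) ^ ν i - s ^ ν i - t ^ ν i) * |b.repr ⁅b j, b k⁆ i| := by
    intro j k
    by_cases h0 : b.repr ⁅b j, b k⁆ i = 0
    · simp [h0]
    · rw [abs_mul, abs_mul, ← weight_add_eq hD hDb h0]
      refine mul_le_mul_of_nonneg_right ?_ (abs_nonneg _)
      calc |b.repr x j| * |b.repr y k| ≤ (ε * s ^ ν j) * (ε * t ^ ν k) :=
            mul_le_mul (hx j) (hy k) (abs_nonneg _) (mul_nonneg hε (Real.rpow_nonneg hs _))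
        _ = ε * ε * (s ^ ν j * t ^ ν k) := by ring
        _ ≤ _ := mul_le_mul_of_nonneg_left (rpow_mul_rpow_le hs ht (hν j) (hν k))
            (mul_nonneg hε hε)
  rw [repr_lie, Finset.mul_sum]
  refine (Finset.abs_sum_le_sum_abs _ _).trans (Finset.sum_le_sum fun j _ => ?_)
  rw [Finset.mul_sum]
  exact (Finset.abs_sum_le_sum_abs _ _).trans (Finset.sum_le_sum fun k _ => hterm j k)

theorem boxGauge_mul_le {E : Type*} [LieRing E] [LieAlgebra ℝ E] [Group E] [TwoStepExpGroup E]
    {D : ℝ → E →ₗ[ℝ] E} {m : ℕ} {b : Module.Basis (Fin m) ℝ E} {ν : Fin m → ℝ}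
    (hD : IsDilationFamily D)
    (hDb : ∀ r : ℝ, 0 < r → ∀ i, D r (b i) = (r ^ ν i : ℝ) • b i) (hν : ∀ i, 1 ≤ ν i)
    {ε : ℝ} (hε : 0 < ε) (hεC : ∀ i, ε * ∑ j, ∑ k, |b.repr ⁅b j, b k⁆ i| ≤ 1) (x y : E) :
    boxGauge b ν ε (x * y) ≤ boxGauge b ν ε x + boxGauge b ν ε y := by
  have hν0 : ∀ i, 0 < ν i := fun i => one_pos.trans_le (hν i)
  have hs := boxGauge_nonneg (b := b) (ν := ν) (ε := ε) x
  have ht := boxGauge_nonneg (b := b) (ν := ν) (ε := ε) y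
  have hx := (boxGauge_le_iff hν0 hε hs).1 le_rfl
  have hy := (boxGauge_le_iff hν0 hε ht).1 le_rfl
  generalize boxGauge b ν ε x = s at hs hx ⊢
  generalize boxGauge b ν ε y = t at ht hy ⊢
  refine (boxGauge_le_iff hν0 hε (add_nonneg hs ht)).2 fun i => ?_
  have hlie := abs_repr_lie_le hD hDb hν hε.le hs ht hx hy i
  have hδ := Real.add_rpow_le_rpow_add hs ht (hν i)
  have hsplit : b.repr (x * y) i = b.repr x i + b.repr y i + 1 / 2 * b.repr ⁅x, y⁆ i := by
    rw [TwoStepExpGroup.mul_eq_bch]; simp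
  have h1 := abs_add_le (b.repr x i + b.repr y i) (1 / 2 * b.repr ⁅x, y⁆ i)
  have h2 := abs_add_le (b.repr x i) (b.repr y i)
  rw [abs_mul, abs_of_pos (by norm_num : (0 : ℝ) < 1 / 2)] at h1
  have hεC' := hεC i
  have hxi := hx i
  have hyi := hy i
  rw [hsplit]
  generalize (∑ j, ∑ k, |b.repr ⁅b j, b k⁆ i|) = C at hlie hεC'
  generalize (s + t) ^ ν i = p at *
  generalize s ^ ν i = q at *
  generalize t ^ ν i = w at *
  have h3 : ε * ε * (p - q - w) * C ≤ ε * (p - q - w) :=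
    calc ε * ε * (p - q - w) * C = (ε * C) * (ε * (p - q - w)) := by ring
      _ ≤ 1 * (ε * (p - q - w)) :=
        mul_le_mul_of_nonneg_right hεC' (mul_nonneg hε.le (by linarith))
      _ = ε * (p - q - w) := one_mul _
  have h4 : 0 ≤ ε * (p - q - w) := mul_nonneg hε.le (by linarith)
  linarith

section HomogeneousNorm

variable {E : Type*} [LieRing E] [LieAlgebra ℝ E] [Group E] [TwoStepExpGroup E]
  [TopologicalSpace E] [IsTopologicalAddGroup E] [ContinuousSMul ℝ E] [T2Space E]
  {D : ℝ → E →ₗ[ℝ] E} {n : E → ℝ}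

namespace IsHomogeneousNorm

/-- Homogeneous norms are proper: any one of them dominates a multiple of a box gauge, by
compactness of the unit sphere of the gauge. -/
theorem exists_isCompact (hD : IsDilationFamily D) (hn : IsHomogeneousNorm D n) (R : ℝ) :
    ∃ K : Set E, IsCompact K ∧ ∀ x, n x ≤ R → x ∈ K := by
  obtain ⟨m, b, ν, hν, hDb⟩ := hD.exists_weights
  have : FiniteDimensional ℝ E := b.finiteDimensional_of_finite
  set ρ := boxGauge b ν 1 with hρ
  obtain ⟨K₁, hK₁, hK₁'⟩ := exists_isCompact_box b 1
  have hS : IsCompact (ρ ⁻¹' {1}) := by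
    refine hK₁.of_isClosed_subset (isClosed_singleton.preimage (continuous_boxGauge hν)) ?_
    intro x hx
    refine hK₁' x fun i => ?_
    have := (boxGauge_le_iff (b := b) hν one_pos (x := x) zero_le_one).1 (le_of_eq hx) i
    simpa using this
  obtain ⟨c, hc, hcn⟩ : ∃ c > 0, ∀ x, ρ x = 1 → c ≤ n x := by
    rcases (ρ ⁻¹' {1}).eq_empty_or_nonempty with h | h
    · exact ⟨1, one_pos, fun x hx => absurd (show x ∈ ρ ⁻¹' {1} from hx) (h ▸ Set.notMem_empty x)⟩
    · obtain ⟨x₀, hx₀, hmin⟩ := hS.exists_isMinOn h hn.continuous.continuousOn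
      refine ⟨n x₀, (hn.nonneg _).lt_of_ne' fun h0 => ?_, fun x hx => hmin hx⟩
      rw [hn.eq_zero_iff, one_eq_zero] at h0
      have h1 : ρ x₀ = 1 := hx₀
      rw [h0, hρ, (boxGauge_eq_zero_iff hν one_pos).2 rfl] at h1
      exact zero_ne_one h1
  have hle : ∀ x, c * ρ x ≤ n x := by
    intro x
    rcases (boxGauge_nonneg (b := b) (ν := ν) (ε := 1) x).eq_or_lt with h | h
    · rw [hρ, ← h, mul_zero]; exact hn.nonneg x
    · have hr : 0 < (ρ x)⁻¹ := inv_pos.2 h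
      have h1 := hcn (D (ρ x)⁻¹ x) (by
        rw [hρ, boxGauge_dilation hν one_pos hr (hDb _ hr)]; exact inv_mul_cancel₀ h.ne')
      rw [hn.dilation _ hr, ← div_eq_inv_mul, le_div_iff₀ h] at h1
      exact h1
  have hR : 0 ≤ |R| / c := by positivity
  obtain ⟨M, hM⟩ := (Set.finite_range fun i => (|R| / c) ^ ν i).bddAbove
  obtain ⟨K, hK, hK'⟩ := exists_isCompact_box b M
  refine ⟨K, hK, fun x hx => hK' x fun i => ?_⟩
  have h1 : ρ x ≤ |R| / c := by
    rw [le_div_iff₀' hc]; exact (hle x).trans (hx.trans (le_abs_self R))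
  have := (boxGauge_le_iff (b := b) hν one_pos hR).1 h1 i
  rw [one_mul] at this
  exact this.trans (hM ⟨i, rfl⟩)

theorem exists_pos_of_mem_nhds (hD : IsDilationFamily D) (hn : IsHomogeneousNorm D n) {V : Set E}
    (hV : V ∈ nhds (1 : E)) : ∃ ε > 0, ∀ x, n x < ε → x ∈ V := by
  obtain ⟨K, hK, hK'⟩ := hn.exists_isCompact hD 1
  have hc : IsCompact (K \ interior V) := hK.diff isOpen_interior
  rcases (K \ interior V).eq_empty_or_nonempty with h | h
  · refine ⟨1, one_pos, fun x hx => interior_subset ?_⟩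
    by_contra hxV
    exact h.subset ⟨hK' x hx.le, hxV⟩
  · obtain ⟨x₀, hx₀, hmin⟩ := hc.exists_isMinOn h hn.continuous.continuousOn
    have h0 : 0 < n x₀ := (hn.nonneg _).lt_of_ne' fun h0 => by
      rw [hn.eq_zero_iff] at h0
      exact hx₀.2 (h0 ▸ mem_interior_iff_mem_nhds.2 hV)
    refine ⟨min 1 (n x₀), lt_min one_pos h0, fun x hx => interior_subset ?_⟩
    by_contra hxV
    have h1 : n x₀ ≤ n x := hmin ⟨hK' x (hx.trans_le (min_le_left _ _)).le, hxV⟩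
    exact absurd (hx.trans_le (min_le_right _ _)) (not_lt.2 h1)

end IsHomogeneousNorm

/-- The gauge of a sufficiently small box is a homogeneous norm with convex balls: smallness of the
box makes up for the structure constants in the triangle inequality. Right translations are affine,
so that all balls are convex as soon as those around the neutral element are. -/
theorem exists_convex_homogeneousNorm (hD : IsDilationFamily D) (hn : IsHomogeneousNorm D n) :
    ∃ n' : E → ℝ, IsHomogeneousNorm D n' ∧ ∀ (r : ℝ) (x : E), Convex ℝ (ball n' r x) := by
  obtain ⟨m, b, ν, hν, hDb⟩ := hD.exists_weights
  have hν1 : ∀ i, 1 ≤ ν i := fun i =>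
    hn.one_le_weight (b.ne_zero i) (hν i) fun r hr => hDb r hr i
  set C : ℝ := ∑ i, ∑ j, ∑ k, |b.repr ⁅b j, b k⁆ i| with hC
  have hC0 : 0 ≤ C := by positivity
  obtain ⟨ε, hε, hεC⟩ : ∃ ε > 0, ε * C ≤ 1 := by
    refine ⟨1 / (1 + C), by positivity, ?_⟩
    rw [one_div_mul_eq_div, div_le_one (by positivity)]; linarith
  refine ⟨boxGauge b ν ε, ⟨continuous_boxGauge hν, boxGauge_nonneg, fun x => ?_,
    fun r hr x => boxGauge_dilation hν hε hr (hDb r hr) x, fun x => ?_, fun x y => ?_⟩,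
    fun r x => ?_⟩
  · rw [inv_eq_neg, boxGauge_neg]
  · rw [boxGauge_eq_zero_iff hν hε, one_eq_zero]
  · refine boxGauge_mul_le hD hDb hν1 hε (fun i => ?_) x y
    have hCi : ∑ j, ∑ k, |b.repr ⁅b j, b k⁆ i| ≤ C :=
      Finset.single_le_sum (f := fun i => ∑ j, ∑ k, |b.repr ⁅b j, b k⁆ i|)
        (fun i _ => Finset.sum_nonneg fun j _ => Finset.sum_nonneg fun k _ => abs_nonneg _)
        (Finset.mem_univ i)
    exact (mul_le_mul_of_nonneg_left hCi hε.le).trans hεC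
  · rcases le_or_gt r 0 with hr | hr
    · convert convex_empty (𝕜 := ℝ) (E := E)
      ext y
      simp only [ball, Set.mem_ofPred_eq, EReal.coe_lt_coe_iff, Set.mem_empty_iff_false, iff_false,
        not_lt]
      exact hr.trans (boxGauge_nonneg _)
    · intro y hy z hz α β hα hβ hαβ
      simp only [ball, Set.mem_ofPred_eq, EReal.coe_lt_coe_iff,
        boxGauge_lt_iff hν hε hr] at hy hz ⊢
      intro i
      rw [convexComb_mul _ _ _ hαβ]
      have hc := convex_ball (0 : ℝ) (ε * r ^ ν i)
      have := hc (mem_ball_zero_iff.2 (hy i)) (mem_ball_zero_iff.2 (hz i)) hα hβ hαβ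
      simpa using this

end HomogeneousNorm

/-! ### Balls and radii -/

section Balls

variable {E : Type*} [Group E]

theorem mem_ball_iff {n : E → ℝ} {R : EReal} {x y : E} :
    y ∈ ball n R x ↔ (n (y * x⁻¹) : EReal) < R := Iff.rfl

theorem mem_ball_coe_iff {n : E → ℝ} {r : ℝ} {x y : E} :
    y ∈ ball n (r : EReal) x ↔ n (y * x⁻¹) < r := EReal.coe_lt_coe_iff

theorem ball_subset_ball {n : E → ℝ} {R S : EReal} (h : R ≤ S) (x : E) :
    ball n R x ⊆ ball n S x := fun _ hy => lt_of_lt_of_le hy h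

theorem mem_leftTranslate_iff {s y : E} {A : Set E} : y ∈ leftTranslate s A ↔ s⁻¹ * y ∈ A := by
  constructor
  · rintro ⟨x, hx, rfl⟩; simpa using hx
  · intro h; exact ⟨s⁻¹ * y, h, by simp⟩

/-- The supremum of all `r` with `B_r(c) ∩ A ⊆ B`. For `A = univ` and `B = W` this is the inner
radius at `c`; for a hyperplane `A` and a face `B` it is the size of the face as seen from `c`. -/
noncomputable def relRadius (n : E → ℝ) (A B : Set E) (c : E) : EReal :=
  sSup ((fun r : ℝ => (r : EReal)) '' {r | ball n r c ∩ A ⊆ B})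

variable {n : E → ℝ} {A B : Set E} {c : E}

theorem le_relRadius {r : ℝ} (h : ball n r c ∩ A ⊆ B) : (r : EReal) ≤ relRadius n A B c :=
  le_sSup ⟨r, h, rfl⟩

theorem ball_relRadius_inter_subset : ball n (relRadius n A B c) c ∩ A ⊆ B := by
  rintro y ⟨hy, hyA⟩
  obtain ⟨_, ⟨r, hr, rfl⟩, hlt⟩ := lt_sSup_iff.1 (mem_ball_iff.1 hy)
  exact hr ⟨hlt, hyA⟩

variable [TopologicalSpace E] [IsTopologicalGroup E]

theorem isOpen_ball (hn : Continuous n) (R : EReal) (x : E) : IsOpen (ball n R x) :=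
  isOpen_Iio.preimage
    (continuous_coe_real_ereal.comp (hn.comp (continuous_id.mul continuous_const)))

theorem upperSemicontinuous_relRadius (hn : Continuous n) :
    UpperSemicontinuous (relRadius n A B) := by
  intro x t ht
  obtain ⟨q, hq, hqt⟩ := EReal.lt_iff_exists_real_btwn.1 ht
  obtain ⟨y, ⟨hy, hyA⟩, hyB⟩ : ∃ y, y ∈ ball n q x ∩ A ∧ y ∉ B := by
    by_contra! h
    exact absurd (le_relRadius (n := n) (A := A) (B := B) h) (not_le.2 hq)
  have hc : Continuous fun x' => n (y * x'⁻¹) := hn.comp (continuous_const.mul continuous_inv)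
  have hev := hc.continuousAt.eventually_lt_const (mem_ball_coe_iff.1 hy)
  filter_upwards [hev] with x' hx'
  refine lt_of_le_of_lt (sSup_le ?_) hqt
  rintro _ ⟨r, hr, rfl⟩
  refine EReal.coe_le_coe_iff.2 (le_of_not_gt fun hlt => hyB (hr ⟨?_, hyA⟩))
  exact mem_ball_coe_iff.2 (hx'.trans hlt)

theorem exists_forall_relRadius_le (hn : Continuous n) {K : Set E} (hK : IsCompact K)
    (hne : K.Nonempty) : ∃ c ∈ K, ∀ x ∈ K, relRadius n A B x ≤ relRadius n A B c := by
  obtain ⟨c, hc, h⟩ := UpperSemicontinuousOn.exists_isMaxOn hne hK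
    ((upperSemicontinuous_relRadius (A := A) (B := B) hn).upperSemicontinuousOn K)
  exact ⟨c, hc, fun x hx => h hx⟩

end Balls

theorem IsHomogeneousNorm.map_one {E : Type*} [LieRing E] [LieAlgebra ℝ E] [Group E]
    [TopologicalSpace E] {D : ℝ → E →ₗ[ℝ] E} {n : E → ℝ} (hn : IsHomogeneousNorm D n) : n 1 = 0 :=
  (hn.eq_zero_iff 1).2 rfl

theorem mem_ball_self {E : Type*} [LieRing E] [LieAlgebra ℝ E] [Group E] [TopologicalSpace E]
    {D : ℝ → E →ₗ[ℝ] E} {n : E → ℝ} (hn : IsHomogeneousNorm D n) {R : EReal} (hR : 0 < R) (x : E) :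
    x ∈ ball n R x := by
  rw [mem_ball_iff, mul_inv_cancel, hn.map_one]; exact hR

section

variable {E : Type*} [LieRing E] [LieAlgebra ℝ E] [FiniteDimensional ℝ E] [Group E]
  [TwoStepExpGroup E] [TopologicalSpace E] [IsTopologicalAddGroup E] [ContinuousSMul ℝ E]
  [T2Space E] {D : ℝ → E →ₗ[ℝ] E} {n : E → ℝ}

/-- Balls are a basis of neighbourhoods. -/
theorem IsHomogeneousNorm.exists_ball_subset (hD : IsDilationFamily D)
    (hn : IsHomogeneousNorm D n) {V : Set E} {x : E} (hV : V ∈ nhds x) :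
    ∃ ε > 0, ball n (ε : ℝ) x ⊆ V := by
  have hc : Filter.Tendsto (fun u : E => u * x) (nhds 1) (nhds x) := by
    have hcont : Continuous fun u : E => u * x := by fun_prop
    simpa using hcont.tendsto 1
  obtain ⟨ε, hε, h⟩ := hn.exists_pos_of_mem_nhds hD (hc hV)
  refine ⟨ε, hε, fun y hy => ?_⟩
  have := h _ (mem_ball_coe_iff.1 hy)
  simpa using this

end

/-! ### The window and its faces -/

namespace HalfSpaces

theorem mem_window_iff {H : Type*} [AddCommGroup H] [Module ℝ H] (P : HalfSpaces H) {x : H} :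
    x ∈ P.window ↔ ∀ i, P.normal i x ≤ P.offset i := by
  simp [window, half]

section

variable {H : Type*} [LieRing H] [LieAlgebra ℝ H] [Group H] (P : HalfSpaces H) {n : H → ℝ}

theorem innerRadius_eq_relRadius (c : H) :
    P.innerRadius n c = relRadius n Set.univ P.window c := by
  simp [innerRadius, relRadius]

theorem ball_inter_face_eq_iff {R : EReal} {p : H} {i : Fin P.N} :
    ball n R p ∩ P.face i = ball n R p ∩ P.plane i ↔ ball n R p ∩ P.plane i ⊆ P.face i := by
  constructor
  · intro h; rw [← h]; exact Set.inter_subset_right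
  · intro h
    exact Set.Subset.antisymm (Set.inter_subset_inter_right _ Set.inter_subset_right)
      fun y hy => ⟨hy.1, h hy⟩

theorem relRadius_le_faceSize {p : H} {i : Fin P.N} (hp : p ∈ P.plane i) :
    relRadius n (P.plane i) (P.face i) p ≤ P.faceSize n i := by
  refine sSup_le_sSup (Set.image_mono fun r hr => ?_)
  exact ⟨p, hp, P.ball_inter_face_eq_iff.2 hr⟩

theorem ball_subset_window {c : H} {h : ℝ} (hlt : (h : EReal) < P.innerRadius n c) :
    ball n h c ⊆ P.window := by
  rw [innerRadius_eq_relRadius] at hlt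
  exact fun y hy => ball_relRadius_inter_subset ⟨ball_subset_ball hlt.le c hy, Set.mem_univ y⟩

end

section Linear

variable {H : Type*} [AddCommGroup H] [Module ℝ H] [TopologicalSpace H]
  [IsTopologicalAddGroup H] [ContinuousSMul ℝ H] (P : HalfSpaces H)

theorem isOpenMap_normal (i : Fin P.N) : IsOpenMap (P.normal i) :=
  (P.normal i).isOpenMap_of_finiteDimensional
    (LinearMap.surjective_iff_ne_zero.2 (P.normal_ne_zero i))

theorem dense_compl_plane (i : Fin P.N) : Dense (P.plane i)ᶜ :=
  (dense_compl_singleton (P.offset i)).preimage (P.isOpenMap_normal i)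

theorem normal_lt_of_mem_interior {x : H} (hx : x ∈ interior P.window) (i : Fin P.N) :
    P.normal i x < P.offset i := by
  have h1 : IsOpen (P.normal i '' interior P.window) := P.isOpenMap_normal i _ isOpen_interior
  have h2 : P.normal i '' interior P.window ⊆ Set.Iic (P.offset i) := by
    rintro _ ⟨y, hy, rfl⟩
    exact P.mem_window_iff.1 (interior_subset hy) i
  have h3 := interior_maximal h2 h1 ⟨x, hx, rfl⟩
  rwa [interior_Iic] at h3

/-- Every half-space contributes a face with a relatively interior point: the segment from an
interior point of the window to a point that violates only the half-space `i` crosses `P_i` at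
such a point. -/
theorem exists_mem_plane_forall_lt (h : (interior P.window).Nonempty) (i : Fin P.N) :
    ∃ q ∈ P.plane i, ∀ j, j ≠ i → P.normal j q < P.offset j := by
  obtain ⟨w, hw⟩ := h
  obtain ⟨x, hx, hxi⟩ := P.irredundant i
  have hwi := P.normal_lt_of_mem_interior hw i
  set a := P.normal i w with ha
  set d := P.normal i x with hd
  set o := P.offset i with ho
  have hda : 0 < d - a := by linarith
  refine ⟨((d - o) / (d - a)) • w + ((o - a) / (d - a)) • x, ?_, fun j hj => ?_⟩
  · change P.normal i _ = _
    rw [map_add, map_smul, map_smul, smul_eq_mul, smul_eq_mul, ← ha, ← hd]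
    field_simp
    ring
  · rw [map_add, map_smul, map_smul, smul_eq_mul, smul_eq_mul]
    have h1 : 0 < (d - o) / (d - a) := div_pos (by linarith) hda
    have h2 : 0 ≤ (o - a) / (d - a) := div_nonneg (by linarith) hda.le
    have h3 : (d - o) / (d - a) + (o - a) / (d - a) = 1 := by
      rw [← add_div, div_eq_one_iff_eq hda.ne']; ring
    calc _ < (d - o) / (d - a) * P.offset j + (o - a) / (d - a) * P.offset j :=
          add_lt_add_of_lt_of_le
            (mul_lt_mul_of_pos_left (P.normal_lt_of_mem_interior hw j) h1)
            (mul_le_mul_of_nonneg_left (hx j hj) h2)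
      _ = P.offset j := by rw [← add_mul, h3, one_mul]

/-- If all points of `P_i` near `p` lie in the window, then `p` lies in no other bounding
hyperplane. -/
theorem normal_lt_of_eventually_mem_window (h : (interior P.window).Nonempty) {i : Fin P.N}
    {p : H} (hp : p ∈ P.plane i) (hev : ∀ᶠ y in nhds p, y ∈ P.plane i → y ∈ P.window)
    {j : Fin P.N} (hj : j ≠ i) : P.normal j p < P.offset j := by
  refine lt_of_le_of_ne (P.mem_window_iff.1 (hev.self_of_nhds hp) j) fun hpj => ?_
  obtain ⟨q, hq, hqj⟩ := P.exists_mem_plane_forall_lt h i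
  -- Moving away from the relatively interior point `q` leaves the half-space `j` at once.
  have hc : Filter.Tendsto (fun t : ℝ => p + t • (p - q)) (nhdsWithin 0 (Set.Ioi 0)) (nhds p) := by
    have : Continuous fun t : ℝ => p + t • (p - q) := by fun_prop
    have h0 := this.tendsto 0
    rw [zero_smul, add_zero] at h0
    exact h0.mono_left nhdsWithin_le_nhds
  obtain ⟨t, ht, ht0⟩ := ((hc.eventually hev).and self_mem_nhdsWithin).exists
  have ht0' : 0 < t := ht0
  have hpi : P.normal i p = P.offset i := hp
  have hqi : P.normal i q = P.offset i := hq
  have hmem : p + t • (p - q) ∈ P.plane i := by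
    change P.normal i _ = _
    simp [hpi, hqi]
  have h1 := P.mem_window_iff.1 (ht hmem) j
  rw [map_add, map_smul, map_sub, smul_eq_mul, hpj] at h1
  nlinarith [hqj j hj]

variable [FiniteDimensional ℝ H] [T2Space H]

theorem continuous_normal (i : Fin P.N) : Continuous (P.normal i) :=
  LinearMap.continuous_of_finiteDimensional _

theorem isClosed_window : IsClosed P.window :=
  isClosed_iInter fun i => isClosed_le (P.continuous_normal i) continuous_const

theorem isClosed_plane (i : Fin P.N) : IsClosed (P.plane i) :=
  isClosed_eq (P.continuous_normal i) continuous_const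

theorem eventually_forall_lt {i : Fin P.N} {q : H}
    (hq : ∀ j, j ≠ i → P.normal j q < P.offset j) :
    ∀ᶠ y in nhds q, ∀ j, j ≠ i → P.normal j y < P.offset j := by
  rw [Filter.eventually_all]
  intro j
  by_cases hj : j = i
  · exact Filter.Eventually.of_forall fun y h => absurd hj h
  · filter_upwards [(P.continuous_normal j).continuousAt.eventually_lt_const (hq j hj)] with y hy _
    exact hy

end Linear

section Group

variable {H : Type*} [LieRing H] [LieAlgebra ℝ H] [FiniteDimensional ℝ H] [Group H]
  [TwoStepExpGroup H] [TopologicalSpace H] [IsTopologicalAddGroup H] [ContinuousSMul ℝ H]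
  [T2Space H] (P : HalfSpaces H) {D : ℝ → H →ₗ[ℝ] H} {n : H → ℝ}

theorem isClosed_leftTranslate_plane (s : H) (i : Fin P.N) :
    IsClosed (leftTranslate s (P.plane i)) :=
  (Homeomorph.mulLeft s).isClosedMap _ (P.isClosed_plane i)

theorem dense_compl_leftTranslate_plane (s : H) (i : Fin P.N) :
    Dense (leftTranslate s (P.plane i))ᶜ := by
  have h : (leftTranslate s (P.plane i))ᶜ = (fun y => s⁻¹ * y) ⁻¹' (P.plane i)ᶜ := by
    ext y; simp [mem_leftTranslate_iff]
  rw [h]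
  exact (P.dense_compl_plane i).preimage (Homeomorph.mulLeft s⁻¹).isOpenMap

theorem faceSize_pos (hD : IsDilationFamily D) (hn : IsHomogeneousNorm D n)
    (h : (interior P.window).Nonempty) (i : Fin P.N) : 0 < P.faceSize n i := by
  obtain ⟨q, hq, hqj⟩ := P.exists_mem_plane_forall_lt h i
  obtain ⟨ε, hε, hsub⟩ := hn.exists_ball_subset hD (P.eventually_forall_lt hqj)
  refine lt_of_lt_of_le (EReal.coe_pos.2 hε)
    ((le_relRadius ?_).trans (P.relRadius_le_faceSize hq))
  rintro y ⟨hy, hyi⟩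
  refine ⟨P.mem_window_iff.2 fun j => ?_, hyi⟩
  by_cases hj : j = i
  · subst hj; exact le_of_eq hyi
  · exact (hsub hy j hj).le

theorem minFaceSize_pos (hD : IsDilationFamily D) (hn : IsHomogeneousNorm D n)
    (h : (interior P.window).Nonempty) : 0 < P.minFaceSize n := by
  rcases isEmpty_or_nonempty (Fin P.N) with hN | hN
  · rw [minFaceSize, iInf_of_empty]; exact EReal.coe_lt_top 0
  · obtain ⟨i, hi⟩ := exists_eq_ciInf_of_finite (f := fun i => P.faceSize n i)
    rw [minFaceSize, ← hi]
    exact P.faceSize_pos hD hn h i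

theorem exists_faceCenter (hn : IsHomogeneousNorm D n)
    (hc : IsCompact P.window) (h : (interior P.window).Nonempty) (i : Fin P.N) :
    ∃ p ∈ P.face i, ball n (P.minFaceSize n) p ∩ P.face i =
      ball n (P.minFaceSize n) p ∩ P.plane i := by
  have hne : (P.face i).Nonempty := by
    obtain ⟨q, hq, hqj⟩ := P.exists_mem_plane_forall_lt h i
    refine ⟨q, P.mem_window_iff.2 fun j => ?_, hq⟩
    by_cases hj : j = i
    · subst hj; exact le_of_eq hq
    · exact (hqj j hj).le
  obtain ⟨p, hp, hmax⟩ := exists_forall_relRadius_le (A := P.plane i) (B := P.face i)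
    hn.continuous (hc.inter_right (P.isClosed_plane i)) hne
  refine ⟨p, hp, P.ball_inter_face_eq_iff.2 (Set.Subset.trans ?_
    (ball_relRadius_inter_subset (n := n) (A := P.plane i) (c := p)))⟩
  refine Set.inter_subset_inter_left _ (ball_subset_ball ((iInf_le _ i).trans (sSup_le ?_)) p)
  rintro _ ⟨r, ⟨q, hq, hr⟩, rfl⟩
  rw [ball_inter_face_eq_iff] at hr
  rcases le_or_gt r 0 with hr0 | hr0
  · -- Balls of radius `r ≤ 0` are empty.
    refine le_relRadius ?_
    rintro y ⟨hy, -⟩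
    exact absurd (mem_ball_coe_iff.1 hy) (not_lt.2 (hr0.trans (hn.nonneg _)))
  · exact (le_relRadius hr).trans (hmax q (hr ⟨mem_ball_self hn (EReal.coe_pos.2 hr0) q, hq⟩))

theorem exists_centers (hn : IsHomogeneousNorm D n)
    (hc : IsCompact P.window) (h : (interior P.window).Nonempty) :
    ∃ (c : H) (p : Fin P.N → H), P.IsCenter n c ∧ P.AreFaceCenters n p := by
  obtain ⟨c, hcW, hmax⟩ := exists_forall_relRadius_le (A := Set.univ) (B := P.window)
    hn.continuous hc (h.mono interior_subset)
  choose p hp using P.exists_faceCenter hn hc h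
  refine ⟨c, p, ⟨hcW, fun x hx => ?_⟩, hp⟩
  simp only [innerRadius_eq_relRadius]
  exact hmax x hx

theorem innerRadius_pos (hD : IsDilationFamily D) (hn : IsHomogeneousNorm D n)
    (h : (interior P.window).Nonempty) {c : H} (hc : P.IsCenter n c) :
    0 < P.innerRadius n c := by
  obtain ⟨w, hw⟩ := h
  obtain ⟨ε, hε, hsub⟩ := hn.exists_ball_subset hD (mem_interior_iff_mem_nhds.1 hw)
  refine lt_of_lt_of_le (EReal.coe_pos.2 hε) (le_trans ?_ (hc.2 w (interior_subset hw)))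
  exact le_sSup ⟨ε, hsub, rfl⟩

theorem exists_outerRadius_le (hn : IsHomogeneousNorm D n) (hc : IsCompact P.window) (c : H) :
    ∃ R : ℝ, P.outerRadius n c ≤ R := by
  have hcont : Continuous fun y : H => n (y * c⁻¹) :=
    hn.continuous.comp (continuous_id.mul continuous_const)
  obtain ⟨M, hM⟩ := (hc.image hcont).bddAbove
  refine ⟨M + 1, sInf_le ⟨M + 1, fun y hy => mem_ball_coe_iff.2 ?_, rfl⟩⟩
  exact (hM ⟨y, hy, rfl⟩).trans_lt (lt_add_one M)

/-- Conjugates of small elements by a bounded set of elements are uniformly small. -/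
theorem exists_conj_le (hD : IsDilationFamily D) (hn : IsHomogeneousNorm D n) (R : ℝ) {F : EReal}
    (hF : 0 < F) : ∃ ε > 0, ∀ a, n a ≤ R → ∀ x, n x < ε → (n (a * x * a⁻¹) : EReal) ≤ F := by
  obtain ⟨K, hK, hK'⟩ := hn.exists_isCompact hD R
  have hcont : Continuous fun q : H × H => (n (q.1 * q.2 * q.1⁻¹) : EReal) :=
    continuous_coe_real_ereal.comp (hn.continuous.comp
      ((continuous_fst.mul continuous_snd).mul continuous_fst.inv))
  have hsub : K ×ˢ {(1 : H)} ⊆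
      (fun q : H × H => (n (q.1 * q.2 * q.1⁻¹) : EReal)) ⁻¹' Set.Iio F := by
    rintro ⟨a, x⟩ ⟨-, hx⟩
    obtain rfl : x = 1 := hx
    simpa [hn.map_one] using hF
  obtain ⟨u, v, -, hv, hKu, h1v, huv⟩ := generalized_tube_lemma hK isCompact_singleton
    (isOpen_Iio.preimage hcont) hsub
  obtain ⟨ε, hε, h⟩ := hn.exists_pos_of_mem_nhds hD (hv.mem_nhds (h1v rfl))
  exact ⟨ε, hε, fun a ha x hx =>
    le_of_lt (huv (Set.mk_mem_prod (hKu (hK' a ha)) (h x hx)))⟩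

/-- Near a face center, the window coincides with the half-space that bounds this face. -/
theorem eventually_half_subset_window (hD : IsDilationFamily D) (hn : IsHomogeneousNorm D n)
    (h : (interior P.window).Nonempty) {p : Fin P.N → H} (hp : P.AreFaceCenters n p)
    (i : Fin P.N) : ∀ᶠ y in nhds (p i), y ∈ P.half i → y ∈ P.window := by
  obtain ⟨hpi, hball⟩ := hp i
  have hF := P.minFaceSize_pos hD hn h
  have hev : ∀ᶠ y in nhds (p i), y ∈ P.plane i → y ∈ P.window := by
    filter_upwards [(isOpen_ball hn.continuous _ _).mem_nhds (mem_ball_self hn hF (p i))] with y hy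
      hyi
    exact (P.ball_inter_face_eq_iff.1 hball ⟨hy, hyi⟩).1
  filter_upwards [P.eventually_forall_lt fun j hj =>
    P.normal_lt_of_eventually_mem_window h hpi.2 hev hj] with y hy hyi
  refine P.mem_window_iff.2 fun j => ?_
  by_cases hj : j = i
  · subst hj; exact hyi
  · exact (hy j hj).le

theorem exists_isGoodPair (hD : IsDilationFamily D) (hn : IsHomogeneousNorm D n)
    (hc : IsCompact P.window) (h : (interior P.window).Nonempty) {c : H} {p : Fin P.N → H}
    (hcen : P.IsCenter n c) (hp : P.AreFaceCenters n p) : ∃ k h : ℝ, P.IsGoodPair n c p k h := by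
  obtain ⟨R, hR⟩ := P.exists_outerRadius_le hn hc c
  obtain ⟨ε₁, hε₁0, hε₁⟩ := EReal.lt_iff_exists_real_btwn.1 (P.innerRadius_pos hD hn h hcen)
  rw [EReal.coe_pos] at hε₁0
  obtain ⟨ε₂, hε₂0, hε₂⟩ := exists_conj_le hD hn R (P.minFaceSize_pos hD hn h)
  obtain ⟨ε₃, hε₃0, hε₃⟩ : ∃ ε > 0, ∀ w, n w < ε →
      ∀ i, p i * c⁻¹ * w * c ∈ P.half i → p i * c⁻¹ * w * c ∈ P.window := by
    refine hn.exists_pos_of_mem_nhds hD (V := {w | ∀ i, _ → _}) ?_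
    refine Filter.eventually_all.2 fun i => ?_
    have hcont : Filter.Tendsto (fun w : H => p i * c⁻¹ * w * c) (nhds 1) (nhds (p i)) := by
      have h1 : Continuous fun w : H => p i * c⁻¹ * w * c := by fun_prop
      have := h1.tendsto 1
      simpa using this
    exact hcont.eventually (P.eventually_half_subset_window hD hn h hp i)
  set η := min ε₁ (min ε₂ ε₃) / 2 with hη
  have hmin : 0 < min ε₁ (min ε₂ ε₃) := lt_min hε₁0 (lt_min hε₂0 hε₃0)
  have hη0 : 0 < η := by positivity
  have h1 : 2 * η ≤ ε₁ := by rw [hη]; linarith [min_le_left ε₁ (min ε₂ ε₃)]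
  have h2 : 2 * η ≤ ε₂ := by
    rw [hη]; linarith [min_le_right ε₁ (min ε₂ ε₃), min_le_left ε₂ ε₃]
  have h3 : 2 * η ≤ ε₃ := by
    rw [hη]; linarith [min_le_right ε₁ (min ε₂ ε₃), min_le_right ε₂ ε₃]
  refine ⟨η / 2, η, half_pos hη0, half_lt_self hη0, ?_, fun a ha x hx => ?_, fun i s hs => ?_⟩
  · exact lt_of_le_of_lt (EReal.coe_le_coe_iff.2 (by linarith)) hε₁
  · have ha' : n (a * 1⁻¹) < R := mem_ball_coe_iff.1 (ball_subset_ball hR 1 ha)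
    have hx' := mem_ball_coe_iff.1 hx
    rw [inv_one, mul_one] at ha' hx'
    exact hε₂ a ha'.le x (hx'.trans_le h2)
  · refine Set.Subset.antisymm ?_ ?_
    · rintro y ⟨hy, hyc⟩
      refine ⟨mem_leftTranslate_iff.2 ?_, hyc⟩
      rw [mem_leftTranslate_iff] at hy
      -- `s = u c p_i⁻¹` and `y = v c`, so that `s⁻¹ y = p_i c⁻¹ (u⁻¹ v) c` is close to `p_i`.
      have hu := mem_ball_coe_iff.1 hs
      have hv := mem_ball_coe_iff.1 hyc
      set u := s * (c * (p i)⁻¹)⁻¹ with hu'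
      set v := y * c⁻¹ with hv'
      have hsy : s⁻¹ * y = p i * c⁻¹ * (u⁻¹ * v) * c := by rw [hu', hv']; group
      rw [hsy] at hy ⊢
      refine hε₃ _ ?_ i hy
      calc n (u⁻¹ * v) ≤ n u⁻¹ + n v := hn.mul_le _ _
        _ = n u + n v := by rw [hn.inv]
        _ < ε₃ := by linarith
    · refine Set.inter_subset_inter_left _ ?_
      exact Set.image_mono (Set.iInter_subset _ i)

end Group

end HalfSpaces

/-! ### Patches of the model set -/

section ModelSets

variable {G H : Type*} [Group G] [Group H] {n : G → ℝ} {Γ : Subgroup (G × H)} {W : Set H} {r : ℝ}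
  {g g' : G} {w w' : H}

theorem mem_centeredPatch_iff (hg : (g, w) ∈ Γ) {z : G} :
    z ∈ centeredPatch n (modelSet Γ W) r g ↔ ∃ u, (z, u) ∈ Γ ∧ n z < r ∧ u * w ∈ W := by
  constructor
  · rintro ⟨y, ⟨hy, ⟨⟨y', v⟩, ⟨hv, hvW⟩, hyy⟩⟩, rfl⟩
    obtain rfl : y' = y := hyy
    refine ⟨v * w⁻¹, Γ.mul_mem hv (Γ.inv_mem hg), mem_ball_coe_iff.1 hy, ?_⟩
    simpa using hvW
  · rintro ⟨u, hu, hz, huW⟩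
    refine ⟨z * g, ⟨mem_ball_coe_iff.2 (by simpa using hz), (z * g, u * w),
      ⟨Γ.mul_mem hu hg, huW⟩, rfl⟩, by simp⟩

/-- Patches are read off in `H`: two points have the same `r`-patch if and only if the short
lattice vectors translate their images in `H` into the window simultaneously. -/
theorem centeredPatch_eq_iff (hinj : Set.InjOn Prod.fst (Γ : Set (G × H))) (hg : (g, w) ∈ Γ)
    (hg' : (g', w') ∈ Γ) :
    centeredPatch n (modelSet Γ W) r g = centeredPatch n (modelSet Γ W) r g' ↔
      ∀ z u, (z, u) ∈ Γ → n z < r → (u * w ∈ W ↔ u * w' ∈ W) := by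
  have hmem : ∀ {g : G} {w : H}, (g, w) ∈ Γ → ∀ {z u}, (z, u) ∈ Γ → n z < r →
      (z ∈ centeredPatch n (modelSet Γ W) r g ↔ u * w ∈ W) := by
    intro g w hg z u hu hz
    rw [mem_centeredPatch_iff hg]
    constructor
    · rintro ⟨u', hu', -, h⟩
      obtain rfl : u' = u := congrArg Prod.snd (hinj hu' hu rfl)
      exact h
    · exact fun h => ⟨u, hu, hz, h⟩
  constructor
  · intro h z u hu hz
    rw [← hmem hg hu hz, ← hmem hg' hu hz, h]
  · intro h
    ext z
    rw [mem_centeredPatch_iff hg, mem_centeredPatch_iff hg']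
    exact exists_congr fun u => and_congr_right fun hu => and_congr_right fun hz => h z u hu hz

theorem preAcceptanceDomain_eq_iff (hinj : Set.InjOn Prod.fst (Γ : Set (G × H)))
    (hg : (g, w) ∈ Γ) (hg' : (g', w') ∈ Γ) (hw' : w' ∈ W) :
    preAcceptanceDomain n Γ W r g = preAcceptanceDomain n Γ W r g' ↔
      ∀ z u, (z, u) ∈ Γ → n z < r → (u * w ∈ W ↔ u * w' ∈ W) := by
  constructor
  · intro h
    have hmem : w' ∈ preAcceptanceDomain n Γ W r g' :=
      ⟨g', ⟨⟨(g', w'), ⟨hg', hw'⟩, rfl⟩, rfl⟩, hg'⟩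
    rw [← h] at hmem
    obtain ⟨y, ⟨-, hy⟩, hyΓ⟩ := hmem
    exact (centeredPatch_eq_iff hinj hg hyΓ).1 hy
  · intro h
    have := (centeredPatch_eq_iff hinj hg hg').2 h
    simp only [preAcceptanceDomain, patchClass, this]

theorem inv_mem_slab (hn : ∀ x, n x⁻¹ = n x) {u : H} (hu : u ∈ slab n Γ W r) :
    u⁻¹ ∈ slab n Γ W r := by
  obtain ⟨γ, ⟨hγ, hr, a, ha, b, hb, hab⟩, rfl⟩ := hu
  refine ⟨γ⁻¹, ⟨Γ.inv_mem hγ, ?_, b, hb, a, ha, ?_⟩, rfl⟩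
  · rw [Prod.fst_inv, hn]; exact hr
  · rw [Prod.snd_inv, hab, mul_inv_rev, inv_inv]

end ModelSets

/-! ### Finiteness of the cuts -/

section UniformCPS

variable {G : Type*} [LieRing G] [LieAlgebra ℝ G] [FiniteDimensional ℝ G] [Group G]
  [TwoStepExpGroup G] [TopologicalSpace G] [IsTopologicalAddGroup G] [ContinuousSMul ℝ G]
  [T2Space G]
  {H : Type*} [LieRing H] [LieAlgebra ℝ H] [FiniteDimensional ℝ H] [Group H]
  [TwoStepExpGroup H] [TopologicalSpace H] [IsTopologicalAddGroup H] [ContinuousSMul ℝ H]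
  [T2Space H]
  {DG : ℝ → G →ₗ[ℝ] G} {DH : ℝ → H →ₗ[ℝ] H} {nG : G → ℝ} {nH : H → ℝ} {Γ : Subgroup (G × H)}

theorem finite_lattice_inter (hDG : IsDilationFamily DG) (hnG : IsHomogeneousNorm DG nG)
    [DiscreteTopology Γ] {K : Set H} (hK : IsCompact K) (r : ℝ) :
    {γ : G × H | γ ∈ Γ ∧ nG γ.1 < r ∧ γ.2 ∈ K}.Finite := by
  obtain ⟨L, hL, hL'⟩ := hnG.exists_isCompact hDG r
  have hΓ : IsClosed (Γ : Set (G × H)) := Subgroup.isClosed_of_discrete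
  have hd : IsDiscrete ((L ×ˢ K) ∩ (Γ : Set (G × H))) :=
    IsDiscrete.mono ⟨inferInstanceAs (DiscreteTopology Γ)⟩ Set.inter_subset_right
  refine (((hL.prod hK).inter_right hΓ).finite hd).subset ?_
  rintro γ ⟨hγ, hr, hγK⟩
  exact ⟨⟨hL' _ hr.le, hγK⟩, hγ⟩

theorem finite_slab (hDG : IsDilationFamily DG) (hnG : IsHomogeneousNorm DG nG)
    [DiscreteTopology Γ] {W : Set H} (hW : IsCompact W) (r : ℝ) : (slab nG Γ W r).Finite := by
  have hc : Continuous fun q : H × H => q.1 * q.2⁻¹ := continuous_fst.mul continuous_snd.inv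
  refine Set.Finite.subset
    ((finite_lattice_inter (Γ := Γ) hDG hnG ((hW.prod hW).image hc) r).image Prod.snd) ?_
  refine Set.image_mono ?_
  rintro γ ⟨hγ, hr, a, ha, b, hb, hab⟩
  exact ⟨hγ, hr, (a, b), ⟨ha, hb⟩, hab.symm⟩

theorem finite_latticePart_ball (hDG : IsDilationFamily DG) (hnG : IsHomogeneousNorm DG nG)
    (hDH : IsDilationFamily DH) (hnH : IsHomogeneousNorm DH nH)
    [DiscreteTopology Γ] (k : ℝ) (x : H) (r : ℝ) :
    (latticePart nG Γ (ball nH k x) r).Finite := by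
  obtain ⟨L, hL, hL'⟩ := hnH.exists_isCompact hDH k
  have hc : Continuous fun v : H => v * x := by fun_prop
  refine ((finite_lattice_inter (Γ := Γ) hDG hnG (hL.image hc) r).image Prod.snd).subset ?_
  refine Set.image_mono ?_
  rintro γ ⟨hγ, hr, hx⟩
  refine ⟨hγ, ?_, γ.2 * x⁻¹, hL' _ (mem_ball_coe_iff.1 hx).le, by simp⟩
  simpa using mem_ball_coe_iff.1 hr

/-! ### The upper bound -/

namespace HalfSpaces

variable (P : HalfSpaces H)

/-- The union of the cut hyperplanes is nowhere dense, so a point `w` of `Γ_H` can be moved off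
it without changing which of finitely many translates of `W` contain it. Here `w` lies on the
boundary of no such translate, though it may well lie on a cut hyperplane. -/
theorem exists_mem_compl_cuts {S : Set H} (hS : S.Finite) {w : H}
    (hw : ∀ u ∈ S, u * w ∉ frontier P.window) :
    ∃ v ∈ (⋃ μ ∈ S, ⋃ i, leftTranslate μ (P.plane i))ᶜ,
      ∀ u ∈ S, (u * w ∈ P.window ↔ u * v ∈ P.window) := by
  have hdense : Dense (⋃ μ ∈ S, ⋃ i, leftTranslate μ (P.plane i))ᶜ := by
    have hfin : (S ×ˢ (Set.univ : Set (Fin P.N))).Finite := hS.prod Set.finite_univ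
    have := (hfin.image fun q : H × Fin P.N => (leftTranslate q.1 (P.plane q.2))ᶜ).dense_sInter
      (by
        rintro _ ⟨q, -, rfl⟩
        exact (P.isClosed_leftTranslate_plane q.1 q.2).isOpen_compl)
      (by
        rintro _ ⟨q, -, rfl⟩
        exact P.dense_compl_leftTranslate_plane q.1 q.2)
    convert this using 1
    ext y
    simp only [Set.mem_compl_iff, Set.mem_iUnion, not_exists, Set.mem_sInter, Set.forall_mem_image,
      Set.mem_prod, Set.mem_univ, and_true, Prod.forall]
    exact ⟨fun h a b ha => h a ha b, fun h a ha b => h a b ha⟩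
  have hnear : ∀ᶠ v in nhds w, ∀ u ∈ S, (u * w ∈ P.window ↔ u * v ∈ P.window) := by
    rw [Filter.eventually_all_finite hS]
    intro u hu
    have hcont : Filter.Tendsto (fun v : H => u * v) (nhds w) (nhds (u * w)) :=
      (continuous_const.mul continuous_id).tendsto w
    by_cases hmem : u * w ∈ P.window
    · have hint : u * w ∈ interior P.window := by
        by_contra h
        exact hw u hu ⟨subset_closure hmem, h⟩
      filter_upwards [hcont (isOpen_interior.mem_nhds hint)] with v hv
      exact iff_of_true hmem (interior_subset hv)
    · filter_upwards [hcont (P.isClosed_window.isOpen_compl.mem_nhds hmem)] with v hv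
      exact iff_of_false hmem hv
  obtain ⟨v, hvX, hv⟩ := hdense.inter_nhds_nonempty hnear
  exact ⟨v, hvX, hv⟩

/-- The side of a cut hyperplane is constant on connected components of the complement. -/
theorem mul_mem_window_iff_of_connectedComponents_eq {S : Set H} (hS : ∀ u ∈ S, u⁻¹ ∈ S)
    {v v' : ((⋃ μ ∈ S, ⋃ i, leftTranslate μ (P.plane i))ᶜ : Set H)}
    (h : ConnectedComponents.mk v = ConnectedComponents.mk v') {u : H} (hu : u ∈ S) :
    u * (v : H) ∈ P.window ↔ u * (v' : H) ∈ P.window := by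
  have key : ∀ x y : ((⋃ μ ∈ S, ⋃ i, leftTranslate μ (P.plane i))ᶜ : Set H),
      ConnectedComponents.mk x = ConnectedComponents.mk y → ∀ i, P.normal i (u * y) ≤ P.offset i →
        P.normal i (u * x) ≤ P.offset i := by
    intro x y hxy i hy
    have hc : Continuous fun z : ((⋃ μ ∈ S, ⋃ i, leftTranslate μ (P.plane i))ᶜ : Set H) =>
        P.normal i (u * z) :=
      (P.continuous_normal i).comp (continuous_const.mul continuous_subtype_val)
    have hne : ∀ z : ((⋃ μ ∈ S, ⋃ i, leftTranslate μ (P.plane i))ᶜ : Set H),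
        P.normal i (u * z) ≠ P.offset i := by
      rintro ⟨z, hz⟩ heq
      refine hz (Set.mem_iUnion₂.2 ⟨u⁻¹, hS u hu, Set.mem_iUnion.2 ⟨i, ?_⟩⟩)
      rw [mem_leftTranslate_iff, inv_inv]
      exact heq
    have hclopen : IsClopen {z : ((⋃ μ ∈ S, ⋃ i, leftTranslate μ (P.plane i))ᶜ : Set H) |
        P.normal i (u * z) ≤ P.offset i} := by
      refine ⟨isClosed_le hc continuous_const, ?_⟩
      convert isOpen_lt hc continuous_const using 1
      ext z
      refine ⟨fun hz => lt_of_le_of_ne hz (hne z), fun hz => ?_⟩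
      have hz' : P.normal i (u * z) < P.offset i := hz
      exact hz'.le
    exact hclopen.connectedComponent_subset hy (ConnectedComponents.coe_eq_coe'.1 hxy)
  rw [mem_window_iff, mem_window_iff]
  exact forall_congr' fun i => ⟨key v' v h.symm i, key v v' h i⟩

theorem encard_preAcceptanceDomains_le (hDG : IsDilationFamily DG)
    (hnG : IsHomogeneousNorm DG nG) (hΓ : IsUniformCPS Γ) (hW : IsCompact P.window)
    (hreg : frontier P.window ∩ Prod.snd '' (Γ : Set (G × H)) = ∅) (r : ℝ) :
    (preAcceptanceDomains nG Γ P.window r).encard ≤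
      numComponents (⋃ μ ∈ slab nG Γ P.window r, ⋃ i, leftTranslate μ (P.plane i))ᶜ := by
  have := hΓ.discrete
  have hfin := finite_slab hDG hnG hW r (Γ := Γ)
  have key : ∀ A : preAcceptanceDomains nG Γ P.window r,
      ∃ (x : G) (w : H) (v : ((⋃ μ ∈ slab nG Γ P.window r,
        ⋃ i, leftTranslate μ (P.plane i))ᶜ : Set H)), (x, w) ∈ Γ ∧ w ∈ P.window ∧
        A.1 = preAcceptanceDomain nG Γ P.window r x ∧
        ∀ u ∈ slab nG Γ P.window r, (u * w ∈ P.window ↔ u * v ∈ P.window) := by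
    rintro ⟨A, x, ⟨⟨x', w⟩, ⟨hx, hw⟩, hxx⟩, hA⟩
    obtain rfl : x' = x := hxx
    obtain ⟨v, hv, hvw⟩ := P.exists_mem_compl_cuts hfin (w := w) (by
      rintro _ ⟨γ, ⟨hγ, -⟩, rfl⟩ hmem
      exact hreg.subset ⟨hmem, γ * (x', w), Γ.mul_mem hγ hx, rfl⟩)
    exact ⟨x', w, ⟨v, hv⟩, hx, hw, hA, hvw⟩
  choose x w v hx hw hA hv using key
  refine ENat.card_le_card_of_injective
    (f := fun A => ConnectedComponents.mk (v A)) fun A B hAB => Subtype.ext ?_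
  rw [hA A, hA B, preAcceptanceDomain_eq_iff hΓ.injOn_fst (hx A) (hx B) (hw B)]
  intro z u hu hz
  -- Translates by lattice vectors outside the slab miss the window altogether.
  have hslab : ∀ C, u * w C ∈ P.window → u ∈ slab nG Γ P.window r := fun C hC =>
    ⟨(z, u), ⟨hu, hz, u * w C, hC, w C, hw C, by simp⟩, rfl⟩
  by_cases hmem : u ∈ slab nG Γ P.window r
  · rw [hv A u hmem, hv B u hmem]
    exact P.mul_mem_window_iff_of_connectedComponents_eq
      (fun _ => inv_mem_slab hnG.inv) hAB hmem
  · exact iff_of_false (fun h => hmem (hslab A h)) fun h => hmem (hslab B h)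

/-! ### The lower bound -/

/-- Points on the same side of all cut hyperplanes are joined by a convex set that avoids the
cuts. -/
theorem connectedComponents_eq_of_forall_iff {H : Type*} [LieRing H] [LieAlgebra ℝ H] [Group H]
    [TwoStepExpGroup H] [TopologicalSpace H] [IsTopologicalAddGroup H] [ContinuousSMul ℝ H]
    (P : HalfSpaces H) {B : Set H} (hB : Convex ℝ B)
    {S : Fin P.N → Set H}
    {v v' : (B \ ⋃ i, ⋃ s ∈ S i, leftTranslate s (P.plane i) : Set H)}
    (h : ∀ i, ∀ s ∈ S i, (P.normal i (s⁻¹ * v) < P.offset i ↔ P.normal i (s⁻¹ * v') < P.offset i)) :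
    ConnectedComponents.mk v = ConnectedComponents.mk v' := by
  have hne : ∀ z : (B \ ⋃ i, ⋃ s ∈ S i, leftTranslate s (P.plane i) : Set H), ∀ i, ∀ s ∈ S i,
      P.normal i (s⁻¹ * z) ≠ P.offset i := by
    intro z i s hs hzs
    exact z.2.2 (Set.mem_iUnion.2 ⟨i, Set.mem_iUnion₂.2 ⟨s, hs, mem_leftTranslate_iff.2 hzs⟩⟩)
  set C : Set H := segment ℝ (v : H) v' with hC
  have hCsub : C ⊆ (B \ ⋃ i, ⋃ s ∈ S i, leftTranslate s (P.plane i) : Set H) := by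
    rintro _ ⟨a, b, ha, hb, hab, rfl⟩
    refine ⟨hB v.2.1 v'.2.1 ha hb hab, fun hmem => ?_⟩
    obtain ⟨i, hi⟩ := Set.mem_iUnion.1 hmem
    obtain ⟨s, hs, hsi⟩ := Set.mem_iUnion₂.1 hi
    rw [mem_leftTranslate_iff, mul_convexComb _ _ _ hab] at hsi
    have heq : P.normal i (a • (s⁻¹ * v) + b • (s⁻¹ * v')) = P.offset i := hsi
    rw [map_add, map_smul, map_smul, smul_eq_mul, smul_eq_mul] at heq
    rcases lt_or_gt_of_ne (hne v i s hs) with h1 | h1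
    · have h2 := (h i s hs).1 h1
      have := (convex_Iio (P.offset i)) h1 h2 ha hb hab
      exact absurd heq (ne_of_lt this)
    · have h2 : P.offset i < P.normal i (s⁻¹ * v') :=
        lt_of_le_of_ne (not_lt.1 fun h' => absurd ((h i s hs).2 h') (not_lt.2 h1.le))
          (hne v' i s hs).symm
      have := (convex_Ioi (P.offset i)) h1 h2 ha hb hab
      exact absurd heq (ne_of_gt this)
  have hpre : IsPreconnected (Subtype.val ⁻¹' C :
      Set (B \ ⋃ i, ⋃ s ∈ S i, leftTranslate s (P.plane i) : Set H)) := by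
    rw [← Topology.IsInducing.subtypeVal.isPreconnected_image,
      Subtype.image_preimage_coe, Set.inter_eq_right.2 hCsub]
    exact (convex_segment _ _).isPreconnected
  rw [ConnectedComponents.coe_eq_coe']
  exact hpre.subset_connectedComponent (right_mem_segment ℝ (v : H) (v' : H))
    (left_mem_segment ℝ (v : H) (v' : H))

theorem numComponents_le_encard (hDG : IsDilationFamily DG) (hnG : IsHomogeneousNorm DG nG)
    (hDH : IsDilationFamily DH) (hnH : IsHomogeneousNorm DH nH) (hΓ : IsUniformCPS Γ)
    {c : H} {p : Fin P.N → H} {k h : ℝ} (hkh : P.IsGoodPair nH c p k h)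
    (hconv : Convex ℝ (ball nH h c)) (r : ℝ) :
    numComponents (ball nH h c \
        ⋃ i, ⋃ s ∈ latticePart nG Γ (P.region nH c p k i) r, leftTranslate s (P.plane i)) ≤
      (preAcceptanceDomains nG Γ P.window r).encard := by
  have := hΓ.discrete
  set S : Fin P.N → Set H := fun i => latticePart nG Γ (P.region nH c p k i) r with hS
  have hfin : ∀ i, (S i).Finite := fun i =>
    finite_latticePart_ball hDG hnG hDH hnH k (c * (p i)⁻¹) r
  -- Every cell contains a point of `Γ_H`, which lies in the window.
  have key : ∀ v : (ball nH h c \ ⋃ i, ⋃ s ∈ S i, leftTranslate s (P.plane i) : Set H),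
      ∃ (x : G) (w : H), (x, w) ∈ Γ ∧ w ∈ ball nH h c ∧ ∀ i, ∀ s ∈ S i,
        (P.normal i (s⁻¹ * v) < P.offset i ↔ P.normal i (s⁻¹ * w) ≤ P.offset i) := by
    rintro ⟨v, hv, hvS⟩
    have hev : ∀ᶠ w in nhds v, ∀ i, ∀ s ∈ S i,
        (P.normal i (s⁻¹ * v) < P.offset i ↔ P.normal i (s⁻¹ * w) ≤ P.offset i) := by
      rw [Filter.eventually_all]
      intro i
      rw [Filter.eventually_all_finite (hfin i)]
      intro s hs
      have hc : Continuous fun w : H => P.normal i (s⁻¹ * w) :=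
        (P.continuous_normal i).comp (continuous_const.mul continuous_id)
      have hne : P.normal i (s⁻¹ * v) ≠ P.offset i := fun heq =>
        hvS (Set.mem_iUnion.2 ⟨i, Set.mem_iUnion₂.2 ⟨s, hs, mem_leftTranslate_iff.2 heq⟩⟩)
      rcases lt_or_gt_of_ne hne with h1 | h1
      · filter_upwards [hc.continuousAt.eventually_lt_const h1] with w hw
        exact iff_of_true h1 hw.le
      · filter_upwards [hc.continuousAt.eventually_const_lt h1] with w hw
        exact iff_of_false (not_lt.2 h1.le) (not_le.2 hw)
    obtain ⟨w, ⟨⟨x, w'⟩, hx, hww⟩, hw⟩ := hΓ.dense_snd.inter_nhds_nonempty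
      (Filter.inter_mem ((isOpen_ball hnH.continuous _ _).mem_nhds hv) hev)
    obtain rfl : w' = w := hww
    exact ⟨x, w', hx, hw.1, hw.2⟩
  choose x w hx hw hside using key
  have hwW : ∀ v, w v ∈ P.window := fun v => P.ball_subset_window hkh.lt_innerRadius (hw v)
  refine ENat.card_le_card_of_injective (f := fun q : ConnectedComponents
    (ball nH h c \ ⋃ i, ⋃ s ∈ S i, leftTranslate s (P.plane i) : Set H) =>
    (⟨preAcceptanceDomain nG Γ P.window r (x q.out),
      ⟨x q.out, ⟨(x q.out, w q.out), ⟨hx _, hwW _⟩, rfl⟩, rfl⟩⟩ :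
      preAcceptanceDomains nG Γ P.window r)) fun q q' hqq => ?_
  have heq := (preAcceptanceDomain_eq_iff hΓ.injOn_fst (hx _) (hx _) (hwW _)).1
    (congrArg Subtype.val hqq)
  -- Inside the ball the half-spaces `s P_i⁺` agree with the translates `s W`.
  have hhalf : ∀ i, ∀ s ∈ S i, ∀ v, P.normal i (s⁻¹ * w v) ≤ P.offset i ↔
      s⁻¹ * w v ∈ P.window := by
    rintro i s ⟨γ, ⟨-, -, hγ⟩, rfl⟩ v
    have h1 := Set.ext_iff.1 (hkh.half_eq i γ.2 hγ) (w v)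
    simp only [Set.mem_inter_iff, hw v, and_true, mem_leftTranslate_iff] at h1
    exact h1
  rw [← Quotient.out_eq q, ← Quotient.out_eq q']
  refine P.connectedComponents_eq_of_forall_iff hconv fun i s hs => ?_
  rw [hside _ i s hs, hside _ i s hs, hhalf i s hs, hhalf i s hs]
  obtain ⟨γ, ⟨hγ, hr, -⟩, rfl⟩ := hs
  refine heq γ.1⁻¹ γ.2⁻¹ (Γ.inv_mem hγ) ?_
  rw [hnG.inv]
  simpa using mem_ball_coe_iff.1 hr

end HalfSpaces

end UniformCPS

end CutRegions

theorem mainTheorem5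
    {G : Type*} [LieRing G] [LieAlgebra ℝ G] [FiniteDimensional ℝ G] [Group G]
    [TwoStepExpGroup G] [TopologicalSpace G] [IsTopologicalAddGroup G] [ContinuousSMul ℝ G]
    [T2Space G]
    {H : Type*} [LieRing H] [LieAlgebra ℝ H] [FiniteDimensional ℝ H] [Group H]
    [TwoStepExpGroup H] [TopologicalSpace H] [IsTopologicalAddGroup H] [ContinuousSMul ℝ H]
    [T2Space H]
    (DG : ℝ → G →ₗ[ℝ] G) (_hDG : IsDilationFamily DG)
    (DH : ℝ → H →ₗ[ℝ] H) (_hDH : IsDilationFamily DH)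
    (nG : G → ℝ) (_hnG : IsHomogeneousNorm DG nG)
    (nH : H → ℝ) (_hnH : IsHomogeneousNorm DH nH)
    (Γ : Subgroup (G × H)) (_hΓ : IsUniformCPS Γ)
    (P : HalfSpaces H)
    (_hW_precompact : IsCompact (closure P.window))
    (_hW_interior : (interior P.window).Nonempty)
    (_hW_regular : frontier P.window ∩ Prod.snd '' (Γ : Set (G × H)) = ∅) :
    -- the upper bound
    (∀ r : ℝ, 0 < r →
      (preAcceptanceDomains nG Γ P.window r).encard ≤
        numComponents (⋃ μ ∈ slab nG Γ P.window r, ⋃ i, leftTranslate μ (P.plane i))ᶜ) ∧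
    -- centers of the window and of the faces exist, and for any choice of them
    (∃ (c : H) (p : Fin P.N → H), P.IsCenter nH c ∧ P.AreFaceCenters nH p) ∧
    (∀ (c : H) (p : Fin P.N → H), P.IsCenter nH c → P.AreFaceCenters nH p →
      -- there is a good pair, and
      (∃ k h : ℝ, P.IsGoodPair nH c p k h) ∧
      -- every good pair with a convex ball gives the lower bound
      (∀ k h : ℝ, P.IsGoodPair nH c p k h → Convex ℝ (ball nH h c) →
        ball nH h c ⊆ P.window ∧
        ∀ r : ℝ, 0 < r →
          numComponents (ball nH h c \
              ⋃ i, ⋃ s ∈ latticePart nG Γ (P.region nH c p k i) r, leftTranslate s (P.plane i)) ≤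
            (preAcceptanceDomains nG Γ P.window r).encard)) ∧
    -- homogeneous norms on `H` all of whose balls are convex exist
    (∃ n : H → ℝ, IsHomogeneousNorm DH n ∧ ∀ (r : ℝ) (x : H), Convex ℝ (ball n r x)) := by
  have hW : IsCompact P.window := P.isClosed_window.closure_eq ▸ _hW_precompact
  refine ⟨fun r _ => P.encard_preAcceptanceDomains_le _hDG _hnG _hΓ hW _hW_regular r,
    P.exists_centers _hnH hW _hW_interior, fun c p hc hp =>
      ⟨P.exists_isGoodPair _hDH _hnH hW _hW_interior hc hp, fun k h hkh hconv =>
        ⟨P.ball_subset_window hkh.lt_innerRadius, fun r _ =>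
          P.numComponents_le_encard _hDG _hnG _hDH _hnH _hΓ hkh hconv r⟩⟩,
    exists_convex_homogeneousNorm _hDH _hnH⟩
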